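/- **Setting.** Let $G=(V,E)$ be a finite two-player game graph, $V=V_0\uplus V_1$, $E\subseteq V\times V$, in which every node has an outgoing edge. Write $E(v)$ for the set of outgoing edges of $v$ and $E_0=E\cap(V_0\times V)$. Let $w:E\to\{-W,\dots,W\}$ be integer weights, $W\in\mathbb N$, and put $w(v_0\dots v_k)=\sum_{i<k}w(v_i,v_{i+1})$. A Player 0 strategy $\pi$ maps every history $Hv\in V^*V_0$ to an edge of $E(v)$; a $\pi$-play is an infinite path that obeys $\pi$. The quantitative objective $\varphi$ is $MP(w)=\{\rho:\limsup_n \frac1n w(\rho[0;n])\ge 0\}$ or $En(w)$, where $En_c(w)=\{\rho: c+w(\rho[0;i])\ge 0\ \forall i\}$ and $En(w)$ asks for $En_c(w)$ for some finite credit $c$. The qualitative objective $\Phi$ is a parity objective: for $P:V\to\mathbb N$, the largest priority seen infinitely often is even. **Templates.** A QaSTel is a map $\Pi$ from nodes and credits in $\mathbb N\cup\{\infty\}$ to sets $\Pi(v,k)\subseteq E(v)$, monotone in $k$, with $\Pi(v,k)=\emptyset$ for $k<0$; $act_\Pi(e)$ is the least credit from which on $e$ is active, and $\mathrm{minEdges}(v)=\arg\min_{e\in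 E(v)}act_\Pi(e)$. A play $\rho=v_0v_1\dots$ is a $(\Pi,c)$-play if there is $k\in\mathbb N\cup\{\infty\}$ such that $(v_i,v_{i+1})\in\Pi(v_i,c+w(\rho[0;i]))$ for all $i<k$ with $v_i\in V_0$ and, if $k<\infty$, $v_k\in V_0$ and $\Pi(v_k,c+w(\rho[0;k]))=\emptyset$. A MiSTel is a triple $\Lambda=(S,D,\Pi)$ with $S,D\subseteq E_0$. A strategy $\pi$ follows $\Lambda$ with credit $c$ if each $\pi$-play is a $(\Pi,c)$-play, never uses an edge of $S$, and uses each edge of $D$ only finitely often; it follows $\Lambda$ if it does so for some $c\ge W|V|$. $\Lambda$ is conflict-free if $\mathrm{minEdges}(v)\not\subseteq S\cup D$ for all $v\in V$. It is winning from $R\subseteq V$ in $(G,\varphi\wedge\Phi)$ if every strategy following $\Lambda$ wins both $\varphi$ and $\Phi$ from every node of $R$. **Procedures.** *computeQaSTel*$(G,w,\mu)$, for $\mu:E\to\mathbb N\cup\{\infty\}$: starting with $\mu$, replace repeatedly $\mu(u,v)$ by the maximum of $\mu(u,v)$ and $\min_{e'\in E(v)}\max(\mu(e')-w(u,v),0)$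 if $v\in V_0$, resp. $\max_{e'\in E(v)}\max(\mu(e')-w(u,v),0)$ if $v\in V_1$, and replace values above $|V|W$ by $\infty$, until nothing changes. Return $\Pi(u,k)=\{e\in E(u):k\ge\mu(e)\}$ and the region of those $v\in V_0$ (resp. $v\in V_1$) for which some (resp. every) $e\in E(v)$ has $\mu(e)<\infty$. *computePeSTel*$(G,\Phi\wedge \mathit{Safety}(X))$: let $Y$ be the complement of Player 1's attractor to $V\setminus X$. Run on $G|_Y$ the recursion *ParityTemplate*, i.e. Zielonka's recursion annotated with live groups and co-live edges. On a subgame $U$ with priorities at most $d$ (let $T$ be the nodes of priority $d$): if $d=0$, return region $U$ and no live groups or co-live edges; if $d>0$ is even, let $A$ be Player 0's attractor to $T$, solve $U\setminus A$ with bound $d-1$; if its Player 1 part $W_1$ is empty, return region $U$ and add the live groups of the attractor to $T$; otherwise return the result for $U\setminus B$, $B$ being Player 1's attractor to $W_1$; if $d$ is odd, let $A$ be Player 1's attractor to $T$, solve $U\setminus A$ with bound $d-1$, with Player 0 region $W_0$; if $W_0=\emptyset$ return the empty region; otherwise let $B$ be Player 0's attractor to $W_0$, solve $U\setminus B$, and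 return the union of $B$ and the region found there, all live groups and co-live edges found, the live groups of the attractor to $W_0$, and as further co-live edges all Player 0 edges that leave $W_0$. (All attractors are taken in the subgame on $U$. The live groups of a Player 0 attractor consist, layer by layer, of the Player 0 edges from that layer to earlier layers.) Let $Z$ be the region returned. Return $Z$; $S$, the Player 0 edges leaving $Z$; and $D$, the co-live edges together with, for each live group $H$, all edges not in $H\cup S$ that start in a source of an edge of $H$. *findConf*$(\Phi',\mu)$: let $(R_1,(S,D))=$ *computePeSTel*$(G,\Phi')$, $(R_2,\Pi)=$ *computeQaSTel*$(G,w,\mu)$, $R=R_1\cap R_2$; return $R$, the set $C$ of conflicts, i.e. the union of all $\mathrm{minEdges}(v)$ with $v\in R$ and $\mathrm{minEdges}(v)\subseteq S\cup D$, and $\Lambda=(S,D,\Pi)$. *computeMiSTel*$(G,w,\Phi)$: run *findConf*$(\Phi,0)$; as long as $C\neq\emptyset$, replace $\Phi$ by $\Phi\wedge\mathit{Safety}(R)$, replace $act_\Pi(e)$ by $\infty$ for all $e\in C$, and run *findConf* again with the new $\Phi$ and $act_\Pi$; finally return $(R,\Lambda)$. **Theorem.** For every such $G$, $w$ and $\Phi$,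 *computeMiSTel*$(G,w,\Phi)$ terminates, with a unique result $(R,\Lambda)$. The MiSTel $\Lambda$ is conflict-free, and it is winning from $R$ in the mixed game $(G,\varphi\wedge\Phi)$, both for $\varphi=MP(w)$ and for $\varphi=En(w)$. Moreover, for every $c\ge W|V|$, every strategy that follows $\Lambda$ with credit $c$ wins $En_c(w)$ and $\Phi$ from every node of $R$. -/

import Mathlib

noncomputable section

open Filter

namespace MixedGames

/-! ### Game graphs, plays, strategies, objectives -/

/-- A two-player game graph on the finite node set `V`: Player 0 owns the nodes in `V0`,
Player 1 owns the other ones. -/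
structure GameGraph (V : Type*) where
  V0 : Finset V
  E : Finset (V × V)

variable {V : Type*} [Fintype V] [DecidableEq V]

/-- The outgoing edges `E(v)` of a node. -/
def GameGraph.out (G : GameGraph V) (v : V) : Finset (V × V) := G.E.filter (fun e => e.1 = v)

/-- The edges `E₀` that originate from nodes of Player 0. -/
def GameGraph.E0 (G : GameGraph V) : Finset (V × V) := G.E.filter (fun e => e.1 ∈ G.V0)

/-- Plays: infinite paths. -/
def IsPlay (G : GameGraph V) (ρ : ℕ → V) : Prop := ∀ i, (ρ i, ρ (i + 1)) ∈ G.E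

/-- A Player 0 strategy maps a history `H · v` with `v ∈ V0` to an outgoing edge of `v`
(its value at nodes of Player 1 is never used). -/
structure Strategy (G : GameGraph V) where
  move : List V → V → V × V
  move_mem : ∀ H v, v ∈ G.V0 → move H v ∈ G.out v

/-- `ρ` is a `π`-play. -/
def Strategy.IsPlayOf {G : GameGraph V} (π : Strategy G) (ρ : ℕ → V) : Prop :=
  IsPlay G ρ ∧
    ∀ j, ρ j ∈ G.V0 → π.move ((List.range j).map ρ) (ρ j) = (ρ j, ρ (j + 1))

/-- `π` is winning from the node `v` for the objective `φ ⊆ V^ω`. -/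
def Strategy.WinsFrom {G : GameGraph V} (π : Strategy G) (v : V) (φ : Set (ℕ → V)) : Prop :=
  ∀ ρ, π.IsPlayOf ρ → ρ 0 = v → ρ ∈ φ

/-- The weight `w(ρ[0;i])` of the prefix with `i` edges. -/
def prefixWeight (w : V × V → ℤ) (ρ : ℕ → V) (i : ℕ) : ℤ :=
  ∑ j ∈ Finset.range i, w (ρ j, ρ (j + 1))

/-- The energy objective `En_c(w)` with initial credit `c`. -/
def energyObj (w : V × V → ℤ) (c : ℕ) : Set (ℕ → V) :=
  {ρ | ∀ i, 0 ≤ (c : ℤ) + prefixWeight w ρ i}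

/-- The mean-payoff objective `MP(w)`: the limit superior of the average weights is nonnegative. -/
def meanPayoffObj (w : V × V → ℤ) : Set (ℕ → V) :=
  {ρ | 0 ≤ limsup (fun n : ℕ => (1 / (n : ℝ)) * (prefixWeight w ρ n : ℝ)) atTop}

/-- The nodes that are visited infinitely often. -/
def infNodes (ρ : ℕ → V) : Set V := {v | ∃ᶠ i in atTop, ρ i = v}

/-- The parity objective: the highest priority seen infinitely often is even. -/
def parityObj (P : V → ℕ) : Set (ℕ → V) :=
  {ρ | ∃ m, IsGreatest (P '' infNodes ρ) m ∧ Even m}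

/-! ### Strategy templates -/

/-- A quantitative strategy template: the edges activated at a node by a credit in `ℕ∞`,
monotone in the credit. -/
structure QaSTel (G : GameGraph V) where
  edges : V → ℕ∞ → Finset (V × V)
  edges_subset : ∀ v k, edges v k ⊆ G.out v
  mono : ∀ v k k', k ≤ k' → edges v k ⊆ edges v k'

/-- Extension of a template to integer credits: no edge is active at a negative credit. -/
def QaSTel.active {G : GameGraph V} (Q : QaSTel G) (v : V) (c : ℤ) : Finset (V × V) :=
  if c < 0 then ∅ else Q.edges v (c.toNat : ℕ∞)

/-- The activation function: the smallest credit from which on `e` is activated. -/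
def QaSTel.act {G : GameGraph V} (Q : QaSTel G) (e : V × V) : ℕ∞ :=
  sInf {k : ℕ∞ | ∀ k', k ≤ k' → e ∈ Q.edges e.1 k'}

/-- `ρ` is a `(Π,c)`-play: either Player 0 uses active edges forever (`k = ∞`), or up to the
moment `k` at which a node of Player 0 without any active edge is reached. -/
def QaSTel.IsPlayOf {G : GameGraph V} (Q : QaSTel G) (w : V × V → ℤ) (c : ℕ) (ρ : ℕ → V) : Prop :=
  IsPlay G ρ ∧ ∃ k : ℕ∞,
    (∀ i : ℕ, (i : ℕ∞) < k → ρ i ∈ G.V0 →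
      (ρ i, ρ (i + 1)) ∈ Q.active (ρ i) ((c : ℤ) + prefixWeight w ρ i)) ∧
    (∀ n : ℕ, k = (n : ℕ∞) →
      ρ n ∈ G.V0 ∧ Q.active (ρ n) ((c : ℤ) + prefixWeight w ρ n) = ∅)

/-- `π` follows the quantitative template with credit `c`. -/
def QaSTel.FollowedBy {G : GameGraph V} (Q : QaSTel G) (w : V × V → ℤ) (c : ℕ)
    (π : Strategy G) : Prop :=
  ∀ ρ, π.IsPlayOf ρ → Q.IsPlayOf w c ρ

/-- A bounded qualitative template: unsafe edges `S` and co-live edges `D` of Player 0. -/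
structure PeSTel (G : GameGraph V) where
  S : Finset (V × V)
  D : Finset (V × V)
  S_subset : S ⊆ G.E0
  D_subset : D ⊆ G.E0

/-- `ρ` never uses an edge of `S`, and uses each edge of `D` only finitely often. -/
def PeSTel.Allows {G : GameGraph V} (Γ : PeSTel G) (ρ : ℕ → V) : Prop :=
  (∀ e ∈ Γ.S, ¬ ∃ i, (ρ i, ρ (i + 1)) = e) ∧
  (∀ e ∈ Γ.D, ¬ ∃ᶠ i in atTop, (ρ i, ρ (i + 1)) = e)

/-- `π` follows the bounded qualitative template. -/
def PeSTel.FollowedBy {G : GameGraph V} (Γ : PeSTel G) (π : Strategy G) : Prop :=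
  ∀ ρ, π.IsPlayOf ρ → Γ.Allows ρ

/-- A mixed strategy template `(S, D, Π)`. -/
structure MiSTel (G : GameGraph V) extends PeSTel G where
  Q : QaSTel G

/-- `minEdges(v)`: the outgoing edges of `v` with the smallest activation value. -/
def QaSTel.minEdges {G : GameGraph V} (Q : QaSTel G) (v : V) : Finset (V × V) :=
  (G.out v).filter (fun e => ∀ e' ∈ G.out v, Q.act e ≤ Q.act e')

/-- A mixed template is conflict-free if no node has all its minimal edges in `S ∪ D`. -/
def MiSTel.ConflictFree {G : GameGraph V} (L : MiSTel G) : Prop :=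
  ∀ v, ¬ L.Q.minEdges v ⊆ L.S ∪ L.D

/-- `π` follows the mixed template with credit `c`. -/
def MiSTel.FollowedWithCredit {G : GameGraph V} (L : MiSTel G) (w : V × V → ℤ) (c : ℕ)
    (π : Strategy G) : Prop :=
  L.toPeSTel.FollowedBy π ∧ L.Q.FollowedBy w c π

/-- `π` follows the mixed template in a mean-payoff game or an energy game with unknown initial
credit: it does so for some credit `c ≥ W · |V|`. -/
def MiSTel.FollowedBy {G : GameGraph V} (L : MiSTel G) (w : V × V → ℤ) (W : ℕ)
    (π : Strategy G) : Prop :=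
  ∃ c : ℕ, W * Fintype.card V ≤ c ∧ L.FollowedWithCredit w c π

/-- The mixed template is winning from `R` in the game with objective `MP(w) ∧ Φ`. -/
def MiSTel.WinningMeanPayoff {G : GameGraph V} (L : MiSTel G) (w : V × V → ℤ) (W : ℕ)
    (Φ : Set (ℕ → V)) (R : Finset V) : Prop :=
  ∀ π : Strategy G, L.FollowedBy w W π →
    ∀ v ∈ R, π.WinsFrom v (meanPayoffObj w) ∧ π.WinsFrom v Φ

/-- The mixed template is winning from `R` in the game with objective `En(w) ∧ Φ`
(unknown initial credit). -/
def MiSTel.WinningEnergy {G : GameGraph V} (L : MiSTel G) (w : V × V → ℤ) (W : ℕ)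
    (Φ : Set (ℕ → V)) (R : Finset V) : Prop :=
  ∀ π : Strategy G, L.FollowedBy w W π →
    ∀ v ∈ R, (∃ c : ℕ, π.WinsFrom v (energyObj w c)) ∧ π.WinsFrom v Φ

/-- The mixed template is winning from `R` in the game with objective `En_c(w) ∧ Φ`
(fixed initial credit `c`). -/
def MiSTel.WinningEnergyFixed {G : GameGraph V} (L : MiSTel G) (w : V × V → ℤ) (c : ℕ)
    (Φ : Set (ℕ → V)) (R : Finset V) : Prop :=
  ∀ π : Strategy G, L.FollowedWithCredit w c π →
    ∀ v ∈ R, π.WinsFrom v (energyObj w c) ∧ π.WinsFrom v Φ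

/-! ### Edge-based value iteration and `computeQaSTel` -/

/-- `l ⊖ x = max (l - x) 0`, with `∞ ⊖ x = ∞`. -/
def ominus (l : ℕ∞) (x : ℤ) : ℕ∞ := l.map (fun n : ℕ => ((n : ℤ) - x).toNat)

/-- The operator `𝕆_E` on edge functions. -/
def opE (G : GameGraph V) (w : V × V → ℤ) (μ : V × V → ℕ∞) (e : V × V) : ℕ∞ :=
  if e.2 ∈ G.V0 then (G.out e.2).inf (fun e' => ominus (μ e') (w e))
  else (G.out e.2).sup (fun e' => ominus (μ e') (w e))

/-- Values above `|V| · W` are replaced by `∞`. -/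
def trunc (V : Type*) [Fintype V] (W : ℕ) (x : ℕ∞) : ℕ∞ :=
  if x ≤ ((Fintype.card V * W : ℕ) : ℕ∞) then x else ⊤

/-- One round of value iteration. Values are only ever lifted, so that an edge whose value has been
set to `∞` keeps it. -/
def liftRound (G : GameGraph V) (w : V × V → ℤ) (W : ℕ) (μ : V × V → ℕ∞) : V × V → ℕ∞ :=
  fun e => trunc V W (max (μ e) (opE G w μ e))

/-- The result of value iteration started in `μ`. The rounds are pointwise increasing and, after the
first one, take values in the finite set `{0, …, |V| · W, ∞}`; so they become stationary, and
the supremum is the stationary value. -/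
def fixPoint (G : GameGraph V) (w : V × V → ℤ) (W : ℕ) (μ : V × V → ℕ∞) : V × V → ℕ∞ :=
  fun e => ⨆ n : ℕ, ((liftRound G w W)^[n] μ) e

/-- The quantitative template `Π(u,k) = {e ∈ E(u) | k ≥ μ(e)}` of an edge function. -/
def templateOf (G : GameGraph V) (μ : V × V → ℕ∞) : QaSTel G where
  edges u k := (G.out u).filter (fun e => μ e ≤ k)
  edges_subset _ _ := Finset.filter_subset _ _
  mono _ _ _ h e he := by
    rw [Finset.mem_filter] at he ⊢
    exact ⟨he.1, he.2.trans h⟩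

/-- The winning region read off from an edge function. -/
def regionOf (G : GameGraph V) (μ : V × V → ℕ∞) : Finset V :=
  Finset.univ.filter (fun v =>
    (v ∈ G.V0 ∧ ∃ e ∈ G.out v, μ e ≠ ⊤) ∨ (v ∉ G.V0 ∧ ∀ e ∈ G.out v, μ e ≠ ⊤))

/-- `computeQaSTel(G, w, μ)`. -/
def computeQaSTel (G : GameGraph V) (w : V × V → ℤ) (W : ℕ) (μ : V × V → ℕ∞) :
    Finset V × QaSTel G :=
  (regionOf G (fixPoint G w W μ), templateOf G (fixPoint G w W μ))

/-! ### `computePeSTel` -/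

/-- Layers of the attractor to `T` of the player who owns the nodes in `A`, in the subgame on `U`.
-/
def attrLayer (G : GameGraph V) (A U T : Finset V) : ℕ → Finset V
  | 0 => T ∩ U
  | n + 1 => attrLayer G A U T n ∪ U.filter (fun v =>
      (v ∈ A ∧ ∃ u ∈ attrLayer G A U T n, (v, u) ∈ G.E) ∨
      (v ∉ A ∧ ∀ u ∈ U, (v, u) ∈ G.E → u ∈ attrLayer G A U T n))

/-- The attractor (the layers are stationary after at most `|V|` rounds). -/
def attr (G : GameGraph V) (A U T : Finset V) : Finset V :=
  attrLayer G A U T (Fintype.card V)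

theorem attr_subset (G : GameGraph V) (A U T : Finset V) : attr G A U T ⊆ U := by
  unfold attr
  induction Fintype.card V with
  | zero => exact Finset.inter_subset_right
  | succ n ih => exact Finset.union_subset ih (Finset.filter_subset _ _)

theorem subset_attr (G : GameGraph V) (A U T : Finset V) : T ∩ U ⊆ attr G A U T := by
  unfold attr
  induction Fintype.card V with
  | zero => exact subset_rfl
  | succ n ih => exact ih.trans Finset.subset_union_left

/-- The live groups that force progress towards `T` in the attractor of Player 0: one group for each
layer, made of the edges from the Player 0 nodes of the layer into the earlier layers. -/
def reachTemplate (G : GameGraph V) (U T : Finset V) : Finset (Finset (V × V)) :=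
  (Finset.range (Fintype.card V)).image (fun n => G.E0.filter (fun e =>
    e.1 ∈ attrLayer G G.V0 U T (n + 1) ∧ e.1 ∉ attrLayer G G.V0 U T n ∧
    e.2 ∈ attrLayer G G.V0 U T n))

/-- Winning region of Player 0, live groups and co-live edges. -/
structure ParityResult (V : Type*) where
  W0 : Finset V
  H : Finset (Finset (V × V))
  D : Finset (V × V)

/-- Zielonka's recursion on the subgame on `U`, in which all priorities are at most `d`, annotated
with live groups and co-live edges. -/
def parityTemplate (G : GameGraph V) (P : V → ℕ) (d : ℕ) (U : Finset V) : ParityResult V :=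
  match d with
  | 0 => ⟨U, ∅, ∅⟩
  | d + 1 =>
    let T := U.filter (fun v => P v = d + 1)
    if Even (d + 1) then
      let A := attr G G.V0 U T
      let r := parityTemplate G P d (U \ A)
      let W1 := (U \ A) \ r.W0
      if W1 = ∅ then ⟨U, r.H ∪ reachTemplate G U T, r.D⟩
      else parityTemplate G P (d + 1) (U \ attr G G.V0ᶜ U W1)
    else
      let A := attr G G.V0ᶜ U T
      let r := parityTemplate G P d (U \ A)
      let B := attr G G.V0 U r.W0
      if B = ∅ then ⟨∅, ∅, ∅⟩
      else
        let r' := parityTemplate G P (d + 1) (U \ B)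
        ⟨B ∪ r'.W0, r.H ∪ reachTemplate G U r.W0 ∪ r'.H,
          r.D ∪ G.E0.filter (fun e => e.1 ∈ r.W0 ∧ e.2 ∉ r.W0) ∪ r'.D⟩
  termination_by (d, U.card)
  decreasing_by
    · exact Prod.Lex.left _ _ (Nat.lt_succ_self d)
    · rename_i h
      refine Prod.Lex.right _ (Finset.card_lt_card ?_)
      obtain ⟨x, hx⟩ := Finset.nonempty_iff_ne_empty.mpr h
      have hxU : x ∈ U := (Finset.mem_sdiff.mp (Finset.mem_sdiff.mp hx).1).1
      have hxB := subset_attr G G.V0ᶜ U _ (Finset.mem_inter.mpr ⟨hx, hxU⟩)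
      exact Finset.ssubset_iff_subset_ne.mpr ⟨Finset.sdiff_subset, fun heq => by
        rw [← heq] at hxU
        exact (Finset.mem_sdiff.mp hxU).2 hxB⟩
    · exact Prod.Lex.left _ _ (Nat.lt_succ_self d)
    · rename_i h
      refine Prod.Lex.right _ (Finset.card_lt_card ?_)
      obtain ⟨x, hxB⟩ := Finset.nonempty_iff_ne_empty.mpr h
      have hxU : x ∈ U := attr_subset G _ U _ hxB
      exact Finset.ssubset_iff_subset_ne.mpr ⟨Finset.sdiff_subset, fun heq => by
        rw [← heq] at hxU
        exact (Finset.mem_sdiff.mp hxU).2 hxB⟩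

/-- Bounding: with the winning region `W0` as safe set, the unsafe edges are those of Player 0
leaving `W0`, and every outgoing edge of a live-group node that is neither in its live group nor
unsafe becomes co-live. -/
def boundTemplate (G : GameGraph V) (r : ParityResult V) : PeSTel G where
  S := G.E0.filter (fun e => e.1 ∈ r.W0 ∧ e.2 ∉ r.W0)
  D := G.E0.filter (fun e => e ∈ r.D ∨
    ∃ H ∈ r.H, e ∉ H ∧ ¬ (e.1 ∈ r.W0 ∧ e.2 ∉ r.W0) ∧ ∃ f ∈ H, f.1 = e.1)
  S_subset := Finset.filter_subset _ _
  D_subset := Finset.filter_subset _ _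

/-- `computePeSTel(G, Parity(P) ∧ Safety(X))`: solve the parity game on the region from which
Player 0 can enforce to stay in `X`, and bound the resulting template. -/
def computePeSTel (G : GameGraph V) (P : V → ℕ) (X : Finset V) : Finset V × PeSTel G :=
  let r := parityTemplate G P (Finset.univ.sup P)
    (Finset.univ \ attr G G.V0ᶜ Finset.univ Xᶜ)
  (r.W0, boundTemplate G r)

/-! ### `computeMiSTel` -/

/-- Joint winning region, conflict edges and mixed template. -/
structure ConfResult (G : GameGraph V) where
  region : Finset V
  conflicts : Finset (V × V)
  mistel : MiSTel G

/-- `findConf` for the qualitative objective `Parity(P) ∧ Safety(X)` and the activation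
function `μ`. -/
def findConf (G : GameGraph V) (w : V × V → ℤ) (W : ℕ) (P : V → ℕ) (X : Finset V)
    (μ : V × V → ℕ∞) : ConfResult G :=
  let p := computePeSTel G P X
  let q := computeQaSTel G w W μ
  { region := p.1 ∩ q.1
    conflicts := (p.1 ∩ q.1).biUnion (fun v =>
      if q.2.minEdges v ⊆ p.2.S ∪ p.2.D then q.2.minEdges v else ∅)
    mistel := { p.2 with Q := q.2 } }

/-- The while loop, as a relation between a loop state (the accumulated safety set `X` and the last
result of `findConf`) and the value returned. -/
inductive MiSTelLoop (G : GameGraph V) (w : V × V → ℤ) (W : ℕ) (P : V → ℕ) :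
    Finset V → ConfResult G → Finset V → MiSTel G → Prop
  | done (X : Finset V) (r : ConfResult G) (h : r.conflicts = ∅) :
      MiSTelLoop G w W P X r r.region r.mistel
  | step (X : Finset V) (r : ConfResult G) (R : Finset V) (L : MiSTel G) (h : r.conflicts ≠ ∅)
      (next : MiSTelLoop G w W P (X ∩ r.region)
        (findConf G w W P (X ∩ r.region)
          (fun e => if e ∈ r.conflicts then ⊤ else r.mistel.Q.act e)) R L) :
      MiSTelLoop G w W P X r R L

/-- `computeMiSTel(G, w, Parity(P))` terminates and returns `(R, L)`. -/
def ComputeMiSTelReturns (G : GameGraph V) (w : V × V → ℤ) (W : ℕ) (P : V → ℕ)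
    (R : Finset V) (L : MiSTel G) : Prop :=
  MiSTelLoop G w W P Finset.univ (findConf G w W P Finset.univ (fun _ => 0)) R L

end MixedGames

end

open MixedGames

namespace MixedGames

open Filter

set_option linter.unusedSectionVars false

variable {V : Type*} [Fintype V] [DecidableEq V]

/-! ### Attractors -/

/-! The loop returns a conflict-free output of `findConf` (`MiSTelLoop.exists_findConf`). Every
output of `findConf`, for any safety set and any initial activation function, is already winning
from its region (`findConf_winningEnergyFixed`), so the earlier rounds play no role in correctness.
The two objectives are handled independently.

Energy: the fixed point of value iteration satisfies `opE μ ≤ μ`. Hence, if the credit covers the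
value of the edge taken, the credit left after it suffices at the next node, and Player 0 never gets
stuck. Truncation bounds finite values by |V|W, so a credit of at least W|V| suffices at every node
of the region. Mean payoff follows because a total weight of at least -c has averages of at least
-c/n.

Parity: `ParityResult.Sound` is carried through Zielonka's recursion. It is one-sided: it speaks of
plays that eventually stay in Player 0's region and respect the annotations, and never of who wins
elsewhere. Its clause `conflictFree` supplies a single edge compatible with all annotations at a
node.

Termination: conflict edges have finite activation and are then set to ∞, while values never
decrease, so the number of edges with finite activation drops. Conflict-freeness inside the region
is the exit condition; outside it, either no edge is unsafe or co-live, or all activations are ∞ and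
the edge from `conflictFree` is minimal. -/

theorem GameGraph.mem_out {G : GameGraph V} {v : V} {e : V × V} :
    e ∈ G.out v ↔ e ∈ G.E ∧ e.1 = v := by
  simp [GameGraph.out]

theorem GameGraph.mem_E0 {G : GameGraph V} {e : V × V} :
    e ∈ G.E0 ↔ e ∈ G.E ∧ e.1 ∈ G.V0 := by
  simp [GameGraph.E0]

theorem mem_attrLayer_succ {G : GameGraph V} {A U T : Finset V} {n : ℕ} {v : V} :
    v ∈ attrLayer G A U T (n + 1) ↔ v ∈ attrLayer G A U T n ∨ (v ∈ U ∧
      ((v ∈ A ∧ ∃ u ∈ attrLayer G A U T n, (v, u) ∈ G.E) ∨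
      (v ∉ A ∧ ∀ u ∈ U, (v, u) ∈ G.E → u ∈ attrLayer G A U T n))) := by
  simp only [attrLayer, Finset.mem_union, Finset.mem_filter]

theorem attrLayer_mono (G : GameGraph V) (A U T : Finset V) : Monotone (attrLayer G A U T) :=
  monotone_nat_of_le_succ fun _ => Finset.subset_union_left

/-- Until the layers become stationary, each round adds a node. At n = |V| the second alternative
would need more than |V| nodes, so `attr` is closed under one more round. -/
theorem attrLayer_succ_eq_or_card_lt (G : GameGraph V) (A U T : Finset V) (n : ℕ) :
    attrLayer G A U T (n + 1) = attrLayer G A U T n ∨ n < (attrLayer G A U T (n + 1)).card := by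
  induction n with
  | zero =>
    by_cases h : attrLayer G A U T 1 = attrLayer G A U T 0
    · exact Or.inl h
    · refine Or.inr (lt_of_le_of_lt (Nat.zero_le _) (Finset.card_lt_card
        ((attrLayer_mono G A U T (Nat.zero_le 1)).lt_of_ne (Ne.symm h))))
  | succ n ih =>
    rcases ih with ih | ih
    · left
      ext v
      rw [mem_attrLayer_succ, ih, ← mem_attrLayer_succ, ih]
    · by_cases h : attrLayer G A U T (n + 1 + 1) = attrLayer G A U T (n + 1)
      · exact Or.inl h
      · exact Or.inr (lt_of_le_of_lt ih (Finset.card_lt_card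
          ((attrLayer_mono G A U T (Nat.le_succ (n + 1))).lt_of_ne (Ne.symm h))))

theorem attrLayer_card_succ (G : GameGraph V) (A U T : Finset V) :
    attrLayer G A U T (Fintype.card V + 1) = attr G A U T :=
  (attrLayer_succ_eq_or_card_lt G A U T _).resolve_right (not_lt.mpr (Finset.card_le_univ _))

/-- Outside of the attractor, its owner has no edge into it. -/
theorem notMem_attr_of_edge {G : GameGraph V} {A U T : Finset V} {v u : V} (hv : v ∈ U)
    (hvA : v ∈ A) (h : v ∉ attr G A U T) (he : (v, u) ∈ G.E) : u ∉ attr G A U T := by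
  intro hu
  refine h ?_
  rw [← attrLayer_card_succ]
  exact mem_attrLayer_succ.mpr (Or.inr ⟨hv, Or.inl ⟨hvA, u, hu, he⟩⟩)

/-- Outside of the attractor, the opponent can stay outside. -/
theorem exists_edge_notMem_attr {G : GameGraph V} {A U T : Finset V} {v : V} (hv : v ∈ U)
    (hvA : v ∉ A) (h : v ∉ attr G A U T) : ∃ u ∈ U \ attr G A U T, (v, u) ∈ G.E := by
  by_contra! hcon
  refine h ?_
  rw [← attrLayer_card_succ]
  refine mem_attrLayer_succ.mpr (Or.inr ⟨hv, Or.inr ⟨hvA, fun u hu he => ?_⟩⟩)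
  by_contra hn
  exact hcon u (Finset.mem_sdiff.mpr ⟨hu, hn⟩) he

/-- Every node of an attractor outside of the target enters it in some layer. -/
theorem exists_attrLayer_entry {G : GameGraph V} {A U T : Finset V} {v : V}
    (h : v ∈ attr G A U T) (hT : v ∉ T) :
    ∃ n < Fintype.card V, v ∈ attrLayer G A U T (n + 1) ∧ v ∉ attrLayer G A U T n := by
  unfold attr at h
  generalize Fintype.card V = m at h ⊢
  induction m with
  | zero => exact absurd (Finset.mem_inter.mp h).1 hT
  | succ m ih =>
    by_cases hm : v ∈ attrLayer G A U T m
    · obtain ⟨n, hn, h'⟩ := ih hm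
      exact ⟨n, hn.trans (Nat.lt_succ_self m), h'⟩
    · exact ⟨m, Nat.lt_succ_self m, h, hm⟩

/-- In an attractor, a node of the opponent outside of the target has all its edges into the
attractor. -/
theorem mem_attr_of_edge {G : GameGraph V} {A U T : Finset V} {v u : V}
    (h : v ∈ attr G A U T) (hT : v ∉ T) (hA : v ∉ A) (hu : u ∈ U) (he : (v, u) ∈ G.E) :
    u ∈ attr G A U T := by
  obtain ⟨n, hn, h1, h2⟩ := exists_attrLayer_entry h hT
  rcases mem_attrLayer_succ.mp h1 with h1 | ⟨-, h1 | h1⟩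
  · exact absurd h1 h2
  · exact absurd h1.1 hA
  · exact attrLayer_mono G A U T hn.le (h1.2 u hu he)

/-- Every node of `U` has a successor in `U`. -/
def IsSubgame (G : GameGraph V) (U : Finset V) : Prop := ∀ v ∈ U, ∃ u ∈ U, (v, u) ∈ G.E

theorem IsSubgame.sdiff_attr {G : GameGraph V} {U : Finset V} (hU : IsSubgame G U)
    (A T : Finset V) : IsSubgame G (U \ attr G A U T) := by
  intro v hv
  obtain ⟨hvU, hv⟩ := Finset.mem_sdiff.mp hv
  by_cases hA : v ∈ A
  · obtain ⟨u, hu, he⟩ := hU v hvU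
    exact ⟨u, Finset.mem_sdiff.mpr ⟨hu, notMem_attr_of_edge hvU hA hv he⟩, he⟩
  · exact exists_edge_notMem_attr hvU hA hv

/-! ### Live groups -/

/-- From some point on, `ρ` leaves sources of edges of `H` along edges of `H`. -/
def ObeysGroup (ρ : ℕ → V) (H : Finset (V × V)) : Prop :=
  ∀ᶠ i in atTop, (∃ f ∈ H, f.1 = ρ i) → (ρ i, ρ (i + 1)) ∈ H

theorem mem_reachTemplate {G : GameGraph V} {U T : Finset V} {H : Finset (V × V)} :
    H ∈ reachTemplate G U T ↔ ∃ n < Fintype.card V, G.E0.filter (fun e =>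
      e.1 ∈ attrLayer G G.V0 U T (n + 1) ∧ e.1 ∉ attrLayer G G.V0 U T n ∧
      e.2 ∈ attrLayer G G.V0 U T n) = H := by
  simp [reachTemplate]

/-- Localises the sources of live groups, so that groups from different parts of the recursion never
constrain the same node. -/
theorem fst_mem_of_mem_reachTemplate {G : GameGraph V} {U T : Finset V} {H : Finset (V × V)}
    (hH : H ∈ reachTemplate G U T) {f : V × V} (hf : f ∈ H) :
    f.1 ∈ attr G G.V0 U T ∧ f.1 ∉ T ∧ f.1 ∈ G.V0 := by
  obtain ⟨n, hn, rfl⟩ := mem_reachTemplate.mp hH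
  obtain ⟨h0, h1, h2, -⟩ := Finset.mem_filter.mp hf
  have hA : f.1 ∈ attr G G.V0 U T := attrLayer_mono G _ U T hn h1
  refine ⟨hA, fun hT => h2 ?_, (GameGraph.mem_E0.mp h0).2⟩
  exact attrLayer_mono G _ U T (Nat.zero_le n)
    (Finset.mem_inter.mpr ⟨hT, attr_subset G _ U T hA⟩)

/-- A node of Player 0 in the attractor has an edge that belongs to all of its live groups. -/
theorem exists_edge_mem_reachTemplate {G : GameGraph V} {U T : Finset V} {v : V}
    (h : v ∈ attr G G.V0 U T) (hT : v ∉ T) (hv : v ∈ G.V0) :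
    ∃ u ∈ attr G G.V0 U T, (v, u) ∈ G.E ∧
      ∀ H ∈ reachTemplate G U T, (∃ f ∈ H, f.1 = v) → (v, u) ∈ H := by
  obtain ⟨n, hn, h1, h2⟩ := exists_attrLayer_entry h hT
  rcases mem_attrLayer_succ.mp h1 with h3 | ⟨-, ⟨-, u, hu, he⟩ | h3⟩
  · exact absurd h3 h2
  · refine ⟨u, attrLayer_mono G _ U T hn.le hu, he, ?_⟩
    rintro H hH ⟨f, hf, rfl⟩
    obtain ⟨m, hm, rfl⟩ := mem_reachTemplate.mp hH
    obtain ⟨-, f1, f2, -⟩ := Finset.mem_filter.mp hf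
    -- Layers increase, so a node enters in only one round; hence only one group can have `v` as a
    -- source.
    have hmn : m = n := by
      rcases lt_trichotomy m n with hlt | heq | hlt
      · exact absurd (attrLayer_mono G _ U T hlt f1) h2
      · exact heq
      · exact absurd (attrLayer_mono G _ U T hlt h1) f2
    subst hmn
    exact Finset.mem_filter.mpr ⟨GameGraph.mem_E0.mpr ⟨he, hv⟩, h1, h2, hu⟩
  · exact absurd hv h3.1

/-- Obeying the live groups of an attractor forces visits of the target. -/
theorem frequently_mem_of_frequently_attr {G : GameGraph V} {U T : Finset V} {ρ : ℕ → V}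
    (hρ : IsPlay G ρ) (hU : ∀ᶠ i in atTop, ρ i ∈ U)
    (hH : ∀ H ∈ reachTemplate G U T, ObeysGroup ρ H)
    (hA : ∃ᶠ i in atTop, ρ i ∈ attr G G.V0 U T) : ∃ᶠ i in atTop, ρ i ∈ T := by
  have hH' := (Finset.eventually_all (reachTemplate G U T)).mpr hH
  obtain ⟨N, hN⟩ := eventually_atTop.mp (hU.and hH')
  -- Past `N` each step from a new layer goes to an earlier one: Player 0 by the live group, Player
  -- 1 because all its edges do.
  have key : ∀ n ≤ Fintype.card V, ∀ i ≥ N, ρ i ∈ attrLayer G G.V0 U T n →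
      ∃ j ≥ i, ρ j ∈ T := by
    intro n
    induction n with
    | zero => exact fun _ i _ h => ⟨i, le_rfl, (Finset.mem_inter.mp h).1⟩
    | succ n ih =>
      intro hn i hi h
      by_cases h' : ρ i ∈ attrLayer G G.V0 U T n
      · exact ih (by omega) i hi h'
      have hstep : ρ (i + 1) ∈ attrLayer G G.V0 U T n := by
        rcases mem_attrLayer_succ.mp h with h3 | ⟨-, ⟨h3, u, hu, he⟩ | ⟨-, h3⟩⟩
        · exact absurd h3 h'
        · have hm := (hN i hi).2 _ (mem_reachTemplate.mpr ⟨n, hn, rfl⟩)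
            ⟨(ρ i, u), Finset.mem_filter.mpr
              ⟨GameGraph.mem_E0.mpr ⟨he, h3⟩, h, h', hu⟩, rfl⟩
          exact (Finset.mem_filter.mp hm).2.2.2
        · exact h3 _ (hN (i + 1) (by omega)).1 (hρ i)
      obtain ⟨j, hj, hjT⟩ := ih (by omega) (i + 1) (by omega) hstep
      exact ⟨j, by omega, hjT⟩
  rw [frequently_atTop] at hA ⊢
  intro a
  obtain ⟨b, hb, hbA⟩ := hA (max a N)
  obtain ⟨j, hj, hjT⟩ := key _ le_rfl b ((le_max_right a N).trans hb) hbA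
  exact ⟨j, ((le_max_left a N).trans hb).trans hj, hjT⟩

/-! ### Soundness of the parity template -/

theorem infNodes_nonempty (ρ : ℕ → V) : (infNodes ρ).Nonempty := by
  by_contra h
  rw [Set.not_nonempty_iff_eq_empty, Set.eq_empty_iff_forall_notMem] at h
  have h' : ∀ v, ∀ᶠ i in atTop, ρ i ≠ v := fun v => not_frequently.mp (h v)
  obtain ⟨i, hi⟩ := (eventually_all.mpr h').exists
  exact hi _ rfl

theorem exists_mem_infNodes {ρ : ℕ → V} {T : Finset V} (h : ∃ᶠ i in atTop, ρ i ∈ T) :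
    ∃ v ∈ T, v ∈ infNodes ρ := by
  by_contra! hc
  have h' : ∀ v ∈ T, ∀ᶠ i in atTop, ρ i ≠ v := fun v hv => not_frequently.mp (hc v hv)
  obtain ⟨i, hi, hT⟩ := (((Finset.eventually_all T).mpr h').and_frequently h).exists
  exact hi _ hT rfl

theorem mem_of_mem_infNodes {ρ : ℕ → V} {U : Finset V} (hU : ∀ᶠ i in atTop, ρ i ∈ U) {v : V}
    (hv : v ∈ infNodes ρ) : v ∈ U := by
  obtain ⟨i, hi, hiU⟩ := (Frequently.and_eventually hv hU).exists
  exact hi ▸ hiU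

/-- What the recursion guarantees for the result `r` on the subgame on `U`. -/
structure ParityResult.Sound (G : GameGraph V) (P : V → ℕ) (U : Finset V)
    (r : ParityResult V) : Prop where
  subset : r.W0 ⊆ U
  trap : ∀ v ∈ r.W0, v ∉ G.V0 → ∀ u ∈ U, (v, u) ∈ G.E → u ∈ r.W0
  D_source : ∀ e ∈ r.D, e ∈ G.E0 ∧ e.1 ∈ r.W0
  H_source : ∀ H ∈ r.H, ∀ f ∈ H, f.1 ∈ G.V0 ∧ f.1 ∈ r.W0
  conflictFree : ∀ v ∈ r.W0, v ∈ G.V0 → ∃ u ∈ r.W0, (v, u) ∈ G.E ∧ (v, u) ∉ r.D ∧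
    ∀ H ∈ r.H, (∃ f ∈ H, f.1 = v) → (v, u) ∈ H
  winning : ∀ ρ, IsPlay G ρ → (∀ᶠ i in atTop, ρ i ∈ r.W0) →
    (∀ᶠ i in atTop, (ρ i, ρ (i + 1)) ∉ r.D) → (∀ H ∈ r.H, ObeysGroup ρ H) → ρ ∈ parityObj P

theorem ParityResult.sound_of_priority_zero {G : GameGraph V} {P : V → ℕ} {U : Finset V}
    (hU : IsSubgame G U) (hP : ∀ v ∈ U, P v ≤ 0) : Sound G P U ⟨U, ∅, ∅⟩ where
  subset := subset_rfl
  trap _ _ _ _ hu _ := hu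
  D_source _ he := absurd he (Finset.notMem_empty _)
  H_source _ hH := absurd hH (Finset.notMem_empty _)
  conflictFree v hv _ := by
    obtain ⟨u, hu, he⟩ := hU v hv
    exact ⟨u, hu, he, Finset.notMem_empty _, fun _ hH => absurd hH (Finset.notMem_empty _)⟩
  winning ρ _ hρU _ _ := by
    obtain ⟨v, hv⟩ := infNodes_nonempty ρ
    have h0 : ∀ u ∈ infNodes ρ, P u = 0 := fun u hu =>
      Nat.le_zero.mp (hP u (mem_of_mem_infNodes hρU hu))
    refine ⟨0, ⟨⟨v, hv, h0 v hv⟩, ?_⟩, Even.zero⟩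
    rintro _ ⟨u, hu, rfl⟩
    exact (h0 u hu).le

theorem ParityResult.sound_empty (G : GameGraph V) (P : V → ℕ) (U : Finset V) :
    Sound G P U ⟨∅, ∅, ∅⟩ where
  subset := Finset.empty_subset _
  trap _ hv := absurd hv (Finset.notMem_empty _)
  D_source _ he := absurd he (Finset.notMem_empty _)
  H_source _ hH := absurd hH (Finset.notMem_empty _)
  conflictFree _ hv := absurd hv (Finset.notMem_empty _)
  winning _ _ h _ _ := absurd h.exists.choose_spec (Finset.notMem_empty _)

/-- Player 0 wins everywhere by forcing visits of the nodes of maximal even priority. -/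
theorem ParityResult.Sound.even {G : GameGraph V} {P : V → ℕ} {d : ℕ} {U : Finset V}
    {r : ParityResult V} (hU : IsSubgame G U) (hP : ∀ v ∈ U, P v ≤ d) (hd : Even d)
    {T : Finset V} (hT : T = U.filter (fun v => P v = d))
    (hr : Sound G P (U \ attr G G.V0 U T) r) (hW : U \ attr G G.V0 U T ⊆ r.W0) :
    Sound G P U ⟨U, r.H ∪ reachTemplate G U T, r.D⟩ where
  subset := subset_rfl
  trap _ _ _ _ hu _ := hu
  D_source e he := ⟨(hr.D_source e he).1,
    (Finset.mem_sdiff.mp (hr.subset (hr.D_source e he).2)).1⟩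
  H_source H hH f hf := by
    rcases Finset.mem_union.mp hH with hH | hH
    · exact ⟨(hr.H_source H hH f hf).1,
        (Finset.mem_sdiff.mp (hr.subset (hr.H_source H hH f hf).2)).1⟩
    · have h := fst_mem_of_mem_reachTemplate hH hf
      exact ⟨h.2.2, attr_subset G _ U T h.1⟩
  conflictFree v hv hv0 := by
    by_cases hA : v ∈ attr G G.V0 U T
    -- The recursive call lives outside the attractor, so its annotations do not concern `v`.
    · have hvW : v ∉ r.W0 := fun h => (Finset.mem_sdiff.mp (hr.subset h)).2 hA
      have hD : ∀ u, (v, u) ∉ r.D := fun u h => hvW (hr.D_source _ h).2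
      have hH : ∀ H ∈ r.H, ¬ ∃ f ∈ H, f.1 = v := by
        rintro H hH ⟨f, hf, rfl⟩
        exact hvW (hr.H_source H hH f hf).2
      by_cases hvT : v ∈ T
      · obtain ⟨u, hu, he⟩ := hU v hv
        refine ⟨u, hu, he, hD u, fun H hH' hf => ?_⟩
        rcases Finset.mem_union.mp hH' with h | h
        · exact absurd hf (hH H h)
        · obtain ⟨f, hf, rfl⟩ := hf
          exact absurd hvT (fst_mem_of_mem_reachTemplate h hf).2.1
      · obtain ⟨u, hu, he, hf'⟩ := exists_edge_mem_reachTemplate hA hvT hv0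
        refine ⟨u, attr_subset G _ U T hu, he, hD u, fun H hH' hf => ?_⟩
        rcases Finset.mem_union.mp hH' with h | h
        · exact absurd hf (hH H h)
        · exact hf' H h hf
    · obtain ⟨u, hu, he, hD, hH⟩ :=
        hr.conflictFree v (hW (Finset.mem_sdiff.mpr ⟨hv, hA⟩)) hv0
      refine ⟨u, (Finset.mem_sdiff.mp (hr.subset hu)).1, he, hD, fun H hH' hf => ?_⟩
      rcases Finset.mem_union.mp hH' with h | h
      · exact hH H h hf
      · obtain ⟨f, hf, rfl⟩ := hf
        exact absurd (fst_mem_of_mem_reachTemplate h hf).1 hA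
  winning ρ hρ hρU hρD hρH := by
    by_cases hinf : ∃ᶠ i in atTop, ρ i ∈ attr G G.V0 U T
    · obtain ⟨v, hvT, hv⟩ := exists_mem_infNodes (frequently_mem_of_frequently_attr hρ hρU
        (fun H hH => hρH H (Finset.mem_union_right _ hH)) hinf)
      subst hT
      refine ⟨d, ⟨⟨v, hv, (Finset.mem_filter.mp hvT).2⟩, ?_⟩, hd⟩
      rintro _ ⟨u, hu, rfl⟩
      exact hP u (mem_of_mem_infNodes hρU hu)
    · refine hr.winning ρ hρ ?_ hρD (fun H hH => hρH H (Finset.mem_union_left _ hH))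
      filter_upwards [hρU, not_frequently.mp hinf] with i h1 h2
      exact hW (Finset.mem_sdiff.mpr ⟨h1, h2⟩)

/-- The part of Player 1 may be removed together with its attractor. -/
theorem ParityResult.Sound.of_sdiff_attr {G : GameGraph V} {P : V → ℕ} {U T : Finset V}
    {r : ParityResult V} (hr : Sound G P (U \ attr G G.V0ᶜ U T) r) : Sound G P U r where
  subset := hr.subset.trans Finset.sdiff_subset
  trap v hv hv0 u hu he := by
    -- Apart from `subset`, only this clause mentions the ambient subgame: Player 1 has no edge from
    -- outside its attractor into it.
    obtain ⟨hvU, hvA⟩ := Finset.mem_sdiff.mp (hr.subset hv)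
    exact hr.trap v hv hv0 u (Finset.mem_sdiff.mpr
      ⟨hu, notMem_attr_of_edge hvU (Finset.mem_compl.mpr hv0) hvA he⟩) he
  D_source := hr.D_source
  H_source := hr.H_source
  conflictFree := hr.conflictFree
  winning := hr.winning

/-- The region of Player 0 found in `U`, its attractor, and the region found in the rest. -/
theorem ParityResult.Sound.union {G : GameGraph V} {P : V → ℕ} {U : Finset V}
    {r r' : ParityResult V} (hr : Sound G P U r)
    (hr' : Sound G P (U \ attr G G.V0 U r.W0) r') :
    Sound G P U ⟨attr G G.V0 U r.W0 ∪ r'.W0, r.H ∪ reachTemplate G U r.W0 ∪ r'.H,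
      r.D ∪ G.E0.filter (fun e => e.1 ∈ r.W0 ∧ e.2 ∉ r.W0) ∪ r'.D⟩ := by
  have hWB : r.W0 ⊆ attr G G.V0 U r.W0 := fun v hv =>
    subset_attr G _ U _ (Finset.mem_inter.mpr ⟨hv, hr.subset hv⟩)
  have hBU := attr_subset G G.V0 U r.W0
  have hdisj : ∀ v ∈ r'.W0, v ∉ attr G G.V0 U r.W0 := fun v hv =>
    (Finset.mem_sdiff.mp (hr'.subset hv)).2
  refine ⟨?_, ?_, ?_, ?_, ?_, ?_⟩
  · exact Finset.union_subset hBU (hr'.subset.trans Finset.sdiff_subset)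
  · intro v hv hv0 u hu he
    by_cases huB : u ∈ attr G G.V0 U r.W0
    · exact Finset.mem_union_left _ huB
    refine Finset.mem_union_right _ ?_
    rcases Finset.mem_union.mp hv with hv | hv
    · refine absurd ?_ huB
      by_cases hvW : v ∈ r.W0
      · exact hWB (hr.trap v hvW hv0 u hu he)
      · exact mem_attr_of_edge hv hvW hv0 hu he
    · exact hr'.trap v hv hv0 u (Finset.mem_sdiff.mpr ⟨hu, huB⟩) he
  · intro e he
    simp only [Finset.mem_union, Finset.mem_filter] at he ⊢
    rcases he with (he | he) | he
    · exact ⟨(hr.D_source e he).1, Or.inl (hWB (hr.D_source e he).2)⟩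
    · exact ⟨he.1, Or.inl (hWB he.2.1)⟩
    · exact ⟨(hr'.D_source e he).1, Or.inr (hr'.D_source e he).2⟩
  · intro H hH f hf
    simp only [Finset.mem_union] at hH ⊢
    rcases hH with (hH | hH) | hH
    · exact ⟨(hr.H_source H hH f hf).1, Or.inl (hWB (hr.H_source H hH f hf).2)⟩
    · have h := fst_mem_of_mem_reachTemplate hH hf
      exact ⟨h.2.2, Or.inl h.1⟩
    · exact ⟨(hr'.H_source H hH f hf).1, Or.inr (hr'.H_source H hH f hf).2⟩
  · intro v hv hv0
    simp only [Finset.mem_union, Finset.mem_filter]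
    by_cases hvB : v ∈ attr G G.V0 U r.W0
    · have hv' : v ∉ r'.W0 := fun h => hdisj v h hvB
      have hD' : ∀ u, (v, u) ∉ r'.D := fun u h => hv' (hr'.D_source _ h).2
      have hH' : ∀ H ∈ r'.H, ¬ ∃ f ∈ H, f.1 = v := by
        rintro H hH ⟨f, hf, rfl⟩
        exact hv' (hr'.H_source H hH f hf).2
      by_cases hvW : v ∈ r.W0
      · obtain ⟨u, hu, he, hD, hH⟩ := hr.conflictFree v hvW hv0
        refine ⟨u, Or.inl (hWB hu), he, ?_, ?_⟩
        · rintro ((h | h) | h)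
          · exact hD h
          · exact h.2.2 hu
          · exact hD' u h
        · rintro H ((h | h) | h) hf
          · exact hH H h hf
          · obtain ⟨f, hf, rfl⟩ := hf
            exact absurd hvW (fst_mem_of_mem_reachTemplate h hf).2.1
          · exact absurd hf (hH' H h)
      · obtain ⟨u, hu, he, hH⟩ := exists_edge_mem_reachTemplate hvB hvW hv0
        refine ⟨u, Or.inl hu, he, ?_, ?_⟩
        · rintro ((h | h) | h)
          · exact hvW (hr.D_source _ h).2
          · exact hvW h.2.1
          · exact hD' u h
        · rintro H ((h | h) | h) hf
          · obtain ⟨f, hf, rfl⟩ := hf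
            exact absurd (hr.H_source H h f hf).2 hvW
          · exact hH H h hf
          · exact absurd hf (hH' H h)
    · have hvW' := (Finset.mem_union.mp hv).resolve_left hvB
      have hvW : v ∉ r.W0 := fun h => hvB (hWB h)
      obtain ⟨u, hu, he, hD, hH⟩ := hr'.conflictFree v hvW' hv0
      refine ⟨u, Or.inr hu, he, ?_, ?_⟩
      · rintro ((h | h) | h)
        · exact hvW (hr.D_source _ h).2
        · exact hvW h.2.1
        · exact hD h
      · rintro H ((h | h) | h) hf
        · obtain ⟨f, hf, rfl⟩ := hf
          exact absurd (hr.H_source H h f hf).2 hvW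
        · obtain ⟨f, hf, rfl⟩ := hf
          exact absurd (fst_mem_of_mem_reachTemplate h hf).1 hvB
        · exact hH H h hf
  · intro ρ hρ hρW hρD hρH
    have hρU : ∀ᶠ i in atTop, ρ i ∈ U := by
      filter_upwards [hρW] with i hi
      rcases Finset.mem_union.mp hi with h | h
      · exact hBU h
      · exact (Finset.mem_sdiff.mp (hr'.subset h)).1
    simp only [Finset.mem_union, Finset.mem_filter, not_or] at hρD hρH
    by_cases hinf : ∃ᶠ i in atTop, ρ i ∈ attr G G.V0 U r.W0
    · have hfreq := frequently_mem_of_frequently_attr hρ hρU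
        (fun H hH => hρH H (Or.inl (Or.inr hH))) hinf
      refine hr.winning ρ hρ ?_ (hρD.mono fun i hi => hi.1.1)
        (fun H hH => hρH H (Or.inl (Or.inl hH)))
      -- Past `N`, a visit to `r.W0` is never undone: Player 0's leaving edges are co-live and no
      -- longer used, and Player 1 is trapped.
      obtain ⟨N, hN⟩ := eventually_atTop.mp (hρU.and hρD)
      obtain ⟨M, hM, hMW⟩ := frequently_atTop.mp hfreq N
      refine eventually_atTop.mpr ⟨M, fun i hi => ?_⟩
      induction i, hi using Nat.le_induction with
      | base => exact hMW
      | succ i hi ih =>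
        by_cases h0 : ρ i ∈ G.V0
        · by_contra hcon
          exact (hN i (hM.trans hi)).2.1.2 ⟨GameGraph.mem_E0.mpr ⟨hρ i, h0⟩, ih, hcon⟩
        · exact hr.trap _ ih h0 _ (hN (i + 1) (by omega)).1 (hρ i)
    · refine hr'.winning ρ hρ ?_ (hρD.mono fun i hi => hi.2)
        (fun H hH => hρH H (Or.inr hH))
      filter_upwards [hρW, not_frequently.mp hinf] with i h1 h2
      exact (Finset.mem_union.mp h1).resolve_left h2

/-- The inductions on `d` and on `U` mirror the lexicographic termination order. Either player's
attractor to the nodes of top priority absorbs them all, so the bound drops on the rest. -/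
theorem parityTemplate_sound (G : GameGraph V) (P : V → ℕ) (d : ℕ) (U : Finset V)
    (hU : IsSubgame G U) (hP : ∀ v ∈ U, P v ≤ d) :
    (parityTemplate G P d U).Sound G P U := by
  induction d generalizing U with
  | zero =>
    rw [parityTemplate]
    exact ParityResult.sound_of_priority_zero hU hP
  | succ d ihd =>
    induction U using Finset.strongInduction with
    | H U ihU =>
      have hlow : ∀ A : Finset V, ∀ v ∈ U \ attr G A U (U.filter (fun v => P v = d + 1)),
          P v ≤ d := by
        intro A v hv
        obtain ⟨hvU, hvA⟩ := Finset.mem_sdiff.mp hv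
        refine Nat.le_of_lt_succ (lt_of_le_of_ne (hP v hvU) fun h => hvA ?_)
        exact subset_attr G A U _
          (Finset.mem_inter.mpr ⟨Finset.mem_filter.mpr ⟨hvU, h⟩, hvU⟩)
      have hrec : ∀ A T : Finset V, (attr G A U T).Nonempty →
          (parityTemplate G P (d + 1) (U \ attr G A U T)).Sound G P (U \ attr G A U T) := by
        intro A T hne
        refine ihU _ (Finset.sdiff_ssubset (attr_subset G A U T) hne) (hU.sdiff_attr A T) ?_
        exact fun v hv => hP v (Finset.mem_sdiff.mp hv).1
      rw [parityTemplate]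
      dsimp only
      split_ifs with hd hW hB
      · refine ParityResult.Sound.even hU hP hd rfl
          (ihd _ (hU.sdiff_attr _ _) (hlow _)) (Finset.sdiff_eq_empty_iff_subset.mp hW)
      · refine (hrec _ _ ?_).of_sdiff_attr
        obtain ⟨x, hx⟩ := Finset.nonempty_iff_ne_empty.mpr hW
        exact ⟨x, subset_attr G _ U _ (Finset.mem_inter.mpr
          ⟨hx, (Finset.mem_sdiff.mp (Finset.mem_sdiff.mp hx).1).1⟩)⟩
      · exact ParityResult.sound_empty G P U
      -- Soundness on U \ A passes to U because A is a Player 1 attractor.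
      · exact (ihd _ (hU.sdiff_attr _ _) (hlow _)).of_sdiff_attr.union
          (hrec _ _ (Finset.nonempty_iff_ne_empty.mpr hB))

/-- The parity result from which `computePeSTel` is obtained. -/
theorem exists_sound_of_computePeSTel (G : GameGraph V) (hG : ∀ v, (G.out v).Nonempty)
    (P : V → ℕ) (X : Finset V) : ∃ r : ParityResult V,
      computePeSTel G P X = (r.W0, boundTemplate G r) ∧ r.Sound G P Finset.univ := by
  refine ⟨_, rfl, (parityTemplate_sound G P _ _ (IsSubgame.sdiff_attr ?_ _ _)
    fun v _ => Finset.le_sup (Finset.mem_univ v)).of_sdiff_attr⟩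
  intro v _
  obtain ⟨e, he'⟩ := hG v
  obtain ⟨he, rfl⟩ := GameGraph.mem_out.mp he'
  exact ⟨e.2, Finset.mem_univ _, he⟩

theorem ParityResult.Sound.exists_edge_notMem {G : GameGraph V} {P : V → ℕ}
    {r : ParityResult V} (hr : r.Sound G P Finset.univ) (hG : ∀ v, (G.out v).Nonempty) (v : V) :
    ∃ e ∈ G.out v, e ∉ (boundTemplate G r).S ∪ (boundTemplate G r).D := by
  simp only [boundTemplate, Finset.mem_union, Finset.mem_filter]
  by_cases h0 : v ∈ G.V0
  · by_cases hv : v ∈ r.W0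
    · obtain ⟨u, hu, he, hD, hH⟩ := hr.conflictFree v hv h0
      refine ⟨(v, u), GameGraph.mem_out.mpr ⟨he, rfl⟩, ?_⟩
      rintro (h | ⟨-, h | ⟨H, hH1, hH2, -, hf⟩⟩)
      · exact h.2.2 hu
      · exact hD h
      · exact hH2 (hH H hH1 hf)
    · obtain ⟨e, he⟩ := hG v
      refine ⟨e, he, ?_⟩
      obtain ⟨-, rfl⟩ := GameGraph.mem_out.mp he
      rintro (h | ⟨-, h | ⟨H, hH1, -, -, f, hf, hfe⟩⟩)
      · exact hv h.2.1
      · exact hv (hr.D_source e h).2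
      · exact hv (hfe ▸ (hr.H_source H hH1 f hf).2)
  · obtain ⟨e, he⟩ := hG v
    refine ⟨e, he, ?_⟩
    obtain ⟨-, rfl⟩ := GameGraph.mem_out.mp he
    rintro (h | h) <;> exact h0 (GameGraph.mem_E0.mp h.1).2

theorem ParityResult.Sound.notMem_bound_of_notMem_W0 {G : GameGraph V} {P : V → ℕ}
    {r : ParityResult V} (hr : r.Sound G P Finset.univ) {e : V × V} (he : e.1 ∉ r.W0) :
    e ∉ (boundTemplate G r).S ∪ (boundTemplate G r).D := by
  simp only [boundTemplate, Finset.mem_union, Finset.mem_filter]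
  rintro (h | ⟨-, h | ⟨H, hH1, -, -, f, hf, hfe⟩⟩)
  · exact he h.2.1
  · exact he (hr.D_source e h).2
  · exact he (hfe ▸ (hr.H_source H hH1 f hf).2)

/-- Plays allowed by the bounded template from its region satisfy the parity objective. -/
theorem ParityResult.Sound.parity_of_allows {G : GameGraph V} {P : V → ℕ}
    {r : ParityResult V} (hr : r.Sound G P Finset.univ) {ρ : ℕ → V} (hρ : IsPlay G ρ)
    (h0 : ρ 0 ∈ r.W0) (ha : (boundTemplate G r).Allows ρ) : ρ ∈ parityObj P := by
  obtain ⟨hS, hD⟩ := ha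
  have hin : ∀ i, ρ i ∈ r.W0 := by
    intro i
    induction i with
    | zero => exact h0
    | succ i ih =>
      by_cases hi : ρ i ∈ G.V0
      · by_contra hcon
        exact hS _ (Finset.mem_filter.mpr ⟨GameGraph.mem_E0.mpr ⟨hρ i, hi⟩, ih, hcon⟩) ⟨i, rfl⟩
      · exact hr.trap _ ih hi _ (Finset.mem_univ _) (hρ i)
  have hD' : ∀ᶠ i in atTop, (ρ i, ρ (i + 1)) ∉ (boundTemplate G r).D := by
    filter_upwards [(Finset.eventually_all _).mpr fun e he => not_frequently.mp (hD e he)]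
      with i hi h
    exact hi _ h rfl
  refine hr.winning ρ hρ (Eventually.of_forall hin) ?_ fun H hH => ?_
  · filter_upwards [hD'] with i hi h
    exact hi (Finset.mem_filter.mpr ⟨(hr.D_source _ h).1, Or.inl h⟩)
  -- Bounding turned every other edge of a live-group source that is not unsafe into a co-live one;
  -- the play stays in `r.W0`, so the edge it uses is not unsafe.
  · filter_upwards [hD'] with i hi hf
    by_contra hcon
    refine hi (Finset.mem_filter.mpr ⟨?_, Or.inr ⟨H, hH, hcon, fun h => h.2 (hin _), hf⟩⟩)
    obtain ⟨f, hf, hfi⟩ := hf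
    exact GameGraph.mem_E0.mpr ⟨hρ i, hfi ▸ (hr.H_source H hH f hf).1⟩

/-! ### Value iteration -/

theorem le_trunc (W : ℕ) (x : ℕ∞) : x ≤ trunc V W x := by
  unfold trunc
  split_ifs
  · exact le_rfl
  · exact le_top

theorem trunc_le_or_eq_top (W : ℕ) (x : ℕ∞) :
    trunc V W x ≤ ((Fintype.card V * W : ℕ) : ℕ∞) ∨ trunc V W x = ⊤ := by
  unfold trunc
  split_ifs with h
  · exact Or.inl h
  · exact Or.inr rfl

variable (G : GameGraph V) (w : V × V → ℤ) (W : ℕ) (μ : V × V → ℕ∞)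

theorem iterate_liftRound_mono (e : V × V) :
    Monotone fun n => ((liftRound G w W)^[n] μ) e := by
  refine monotone_nat_of_le_succ fun n => ?_
  rw [Function.iterate_succ_apply']
  exact (le_max_left _ _).trans (le_trunc W _)

theorem le_fixPoint : μ ≤ fixPoint G w W μ := fun e =>
  le_iSup (fun n => ((liftRound G w W)^[n] μ) e) 0

/-- The iterates increase; they either reach ∞ or are naturals bounded by |V|W, and then attain
their supremum. -/
theorem eventually_iterate_eq_fixPoint (e : V × V) :
    ∀ᶠ n in atTop, ((liftRound G w W)^[n] μ) e = fixPoint G w W μ e := by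
  suffices h : ∃ n, ((liftRound G w W)^[n] μ) e = fixPoint G w W μ e by
    obtain ⟨n, hn⟩ := h
    filter_upwards [eventually_ge_atTop n] with m hm
    refine le_antisymm (le_iSup (fun n => ((liftRound G w W)^[n] μ) e) m) ?_
    exact hn ▸ iterate_liftRound_mono G w W μ e hm
  by_cases htop : ∃ n, ((liftRound G w W)^[n] μ) e = ⊤
  · obtain ⟨n, hn⟩ := htop
    exact ⟨n, hn.trans (top_le_iff.mp
      (hn ▸ le_iSup (fun n => ((liftRound G w W)^[n] μ) e) n)).symm⟩
  · push Not at htop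
    have hle : fixPoint G w W μ e ≤ ((Fintype.card V * W : ℕ) : ℕ∞) := by
      -- Only iterates after the first round are truncated, so each one is compared with its
      -- successor.
      refine iSup_le fun n => (iterate_liftRound_mono G w W μ e (Nat.le_succ n)).trans ?_
      have h := htop (n + 1)
      simp only [Function.iterate_succ_apply'] at h ⊢
      exact (trunc_le_or_eq_top W _).resolve_right h
    exact ENat.exists_eq_iSup_of_lt_top (hle.trans_lt (ENat.natCast_lt_top _))

theorem liftRound_fixPoint : liftRound G w W (fixPoint G w W μ) = fixPoint G w W μ := by
  have h := eventually_all.mpr (eventually_iterate_eq_fixPoint G w W μ)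
  obtain ⟨n, hn, hn'⟩ := (h.and ((tendsto_add_atTop_nat 1).eventually h)).exists
  have h1 := funext hn'
  rwa [Function.iterate_succ_apply', funext hn] at h1

theorem opE_fixPoint_le (e : V × V) : opE G w (fixPoint G w W μ) e ≤ fixPoint G w W μ e := by
  conv_rhs => rw [← liftRound_fixPoint G w W μ]
  exact (le_max_right _ _).trans (le_trunc W _)

theorem fixPoint_le_or_eq_top (e : V × V) :
    fixPoint G w W μ e ≤ ((Fintype.card V * W : ℕ) : ℕ∞) ∨ fixPoint G w W μ e = ⊤ := by
  rw [← liftRound_fixPoint G w W μ]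
  exact trunc_le_or_eq_top W _

variable {G w W μ}

theorem le_add_of_ominus_le {l : ℕ∞} {x c : ℤ} (hc : 0 ≤ c)
    (h : ominus l x ≤ (c.toNat : ℕ∞)) : 0 ≤ c + x ∧ l ≤ ((c + x).toNat : ℕ∞) := by
  cases l with
  | top => exact absurd (top_le_iff.mp h) (ENat.natCast_ne_top _)
  | coe n =>
    have h' : ((n : ℤ) - x).toNat ≤ c.toNat := (Nat.cast_le (α := ℕ∞)).mp h
    exact ⟨by omega, Nat.cast_le.mpr (by omega)⟩

/-- The credit `c` suffices at the node `v`. -/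
def Suffices (G : GameGraph V) (μ : V × V → ℕ∞) (v : V) (c : ℤ) : Prop :=
  0 ≤ c ∧ (v ∈ G.V0 → ∃ e ∈ G.out v, μ e ≤ (c.toNat : ℕ∞)) ∧
    (v ∉ G.V0 → ∀ e ∈ G.out v, μ e ≤ (c.toNat : ℕ∞))

/-- One step of the energy invariant. The minimum in `opE` is attained by an edge Player 0 can
choose; the maximum covers every choice of Player 1. -/
theorem suffices_step (hG : ∀ v, (G.out v).Nonempty) {e : V × V} {c : ℤ} (hc : 0 ≤ c)
    (h : opE G w μ e ≤ μ e) (he : μ e ≤ (c.toNat : ℕ∞)) : Suffices G μ e.2 (c + w e) := by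
  have h' := h.trans he
  unfold opE at h'
  by_cases h0 : e.2 ∈ G.V0
  · rw [if_pos h0] at h'
    obtain ⟨e', he', heq⟩ := Finset.exists_mem_eq_inf _ (hG e.2) (fun e' => ominus (μ e') (w e))
    rw [heq] at h'
    obtain ⟨h1, h2⟩ := le_add_of_ominus_le hc h'
    exact ⟨h1, fun _ => ⟨e', he', h2⟩, fun hn => absurd h0 hn⟩
  · rw [if_neg h0] at h'
    have hall := fun e' he' => le_add_of_ominus_le hc (Finset.sup_le_iff.mp h' e' he')
    obtain ⟨e', he'⟩ := hG e.2
    exact ⟨(hall e' he').1, fun hn => absurd hn h0, fun _ e'' he'' => (hall e'' he'').2⟩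

theorem suffices_of_mem_regionOf {v : V} (hv : v ∈ regionOf G (fixPoint G w W μ)) {c : ℕ}
    (hc : W * Fintype.card V ≤ c) : Suffices G (fixPoint G w W μ) v c := by
  have hfin : ∀ e, fixPoint G w W μ e ≠ ⊤ → fixPoint G w W μ e ≤ (((c : ℤ).toNat : ℕ) : ℕ∞) := by
    intro e he
    refine ((fixPoint_le_or_eq_top G w W μ e).resolve_right he).trans ?_
    rw [Int.toNat_natCast, mul_comm]
    exact_mod_cast hc
  simp only [regionOf, Finset.mem_filter, Finset.mem_univ, true_and] at hv
  refine ⟨Int.natCast_nonneg c, fun h0 => ?_, fun h0 e he => ?_⟩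
  · rcases hv with ⟨-, e, he, hfe⟩ | hv
    · exact ⟨e, he, hfin e hfe⟩
    · exact absurd h0 hv.1
  · rcases hv with hv | hv
    · exact absurd hv.1 h0
    · exact hfin e (hv.2 e he)

theorem mem_active_templateOf {v : V} {c : ℤ} {e : V × V} :
    e ∈ (templateOf G μ).active v c ↔ 0 ≤ c ∧ e ∈ G.out v ∧ μ e ≤ (c.toNat : ℕ∞) := by
  unfold QaSTel.active templateOf
  split_ifs with h
  · simp [h]
  · simp [not_lt.mp h]

/-- Plays of the quantitative template from its region satisfy the energy objective. -/
theorem energy_of_isPlayOf (hG : ∀ v, (G.out v).Nonempty) {c : ℕ}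
    (hc : W * Fintype.card V ≤ c) {ρ : ℕ → V} (h0 : ρ 0 ∈ regionOf G (fixPoint G w W μ))
    (hρ : (templateOf G (fixPoint G w W μ)).IsPlayOf w c ρ) : ρ ∈ energyObj w c := by
  obtain ⟨hplay, k, hk, hk'⟩ := hρ
  have key : ∀ i : ℕ, (i : ℕ∞) ≤ k ∧
      Suffices G (fixPoint G w W μ) (ρ i) ((c : ℤ) + prefixWeight w ρ i) := by
    intro i
    induction i with
    | zero => exact ⟨by simp, by simpa [prefixWeight] using suffices_of_mem_regionOf h0 hc⟩
    | succ i ih =>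
      obtain ⟨hik, hs⟩ := ih
      have hlt : (i : ℕ∞) < k := by
        -- The clause for being stuck at time `i` is void: a sufficient credit leaves an active
        -- edge.
        refine lt_of_le_of_ne hik fun heq => ?_
        obtain ⟨hV, hempty⟩ := hk' i heq.symm
        obtain ⟨e, he, hle⟩ := hs.2.1 hV
        exact Finset.notMem_empty e (hempty ▸ mem_active_templateOf.mpr ⟨hs.1, he, hle⟩)
      have hle : fixPoint G w W μ (ρ i, ρ (i + 1)) ≤
          (((c : ℤ) + prefixWeight w ρ i).toNat : ℕ∞) := by
        by_cases hV : ρ i ∈ G.V0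
        · exact (mem_active_templateOf.mp (hk i hlt hV)).2.2
        · exact hs.2.2 hV _ (GameGraph.mem_out.mpr ⟨hplay i, rfl⟩)
      refine ⟨?_, ?_⟩
      · exact_mod_cast Order.add_one_le_of_lt hlt
      · have := suffices_step hG hs.1 (opE_fixPoint_le G w W μ _) hle
        rwa [add_assoc, prefixWeight,
          ← Finset.sum_range_succ (fun j => w (ρ j, ρ (j + 1)))] at this
  exact fun i => (key i).2.1

theorem energyObj_subset_meanPayoffObj (hW : ∀ e ∈ G.E, |w e| ≤ (W : ℤ)) {ρ : ℕ → V}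
    (hρ : IsPlay G ρ) {c : ℕ} (h : ρ ∈ energyObj w c) : ρ ∈ meanPayoffObj w := by
  have hup : ∀ n, prefixWeight w ρ n ≤ n * (W : ℤ) := by
    intro n
    have := Finset.sum_le_card_nsmul (Finset.range n) (fun j => w (ρ j, ρ (j + 1))) (W : ℤ)
      fun j _ => (le_abs_self _).trans (hW _ (hρ j))
    simpa [prefixWeight] using this
  have hlim : Tendsto (fun n : ℕ => -((c : ℝ) / n)) atTop (nhds 0) := by
    simpa using (tendsto_const_div_atTop_nhds_zero_nat (c : ℝ)).neg
  have hle : ∀ n : ℕ, -((c : ℝ) / n) ≤ (1 / (n : ℝ)) * (prefixWeight w ρ n : ℝ) := by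
    intro n
    have h1 : (0 : ℝ) ≤ (c : ℝ) + (prefixWeight w ρ n : ℝ) := by exact_mod_cast h n
    have h2 : (0 : ℝ) ≤ 1 / (n : ℝ) := by positivity
    have h3 := mul_nonneg h2 h1
    have h4 : (1 / (n : ℝ)) * ((c : ℝ) + (prefixWeight w ρ n : ℝ)) =
      (c : ℝ) / n + (1 / (n : ℝ)) * (prefixWeight w ρ n : ℝ) := by ring
    linarith
  -- The real `limsup` is monotone only under boundedness, here supplied by the weight bound; at n =
  -- 0 the average is 0.
  have hbdd : ∀ n : ℕ, (1 / (n : ℝ)) * (prefixWeight w ρ n : ℝ) ≤ W := by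
    intro n
    rcases Nat.eq_zero_or_pos n with rfl | hn
    · simp
    · have h1 : (prefixWeight w ρ n : ℝ) ≤ n * (W : ℝ) := by exact_mod_cast hup n
      have hn' : (0 : ℝ) < n := by exact_mod_cast hn
      rw [one_div, inv_mul_le_iff₀ hn']
      exact h1
  have hmono := limsup_le_limsup (Eventually.of_forall hle) hlim.isCoboundedUnder_le
    (isBoundedUnder_of ⟨(W : ℝ), hbdd⟩)
  rw [hlim.limsup_eq] at hmono
  exact hmono

theorem act_templateOf {e : V × V} (he : e ∈ G.E) : (templateOf G μ).act e = μ e := by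
  have : {k : ℕ∞ | ∀ k', k ≤ k' → e ∈ (templateOf G μ).edges e.1 k'} = Set.Ici (μ e) := by
    ext k
    simp only [templateOf, Finset.mem_filter, GameGraph.mem_out, he, true_and, Set.mem_ofPred_eq,
      Set.mem_Ici]
    exact ⟨fun h => h k le_rfl, fun h k' hk => h.trans hk⟩
  rw [QaSTel.act, this, csInf_Ici]

/-! ### The loop -/

theorem QaSTel.minEdges_nonempty (Q : QaSTel G) {v : V} (h : (G.out v).Nonempty) :
    (Q.minEdges v).Nonempty := by
  obtain ⟨e, he, hmin⟩ := Finset.exists_min_image (G.out v) Q.act h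
  exact ⟨e, Finset.mem_filter.mpr ⟨he, hmin⟩⟩

variable {P : V → ℕ} {X : Finset V}

theorem findConf_conflictFree (hG : ∀ v, (G.out v).Nonempty)
    (h : (findConf G w W P X μ).conflicts = ∅) :
    (findConf G w W P X μ).mistel.ConflictFree := by
  obtain ⟨r, hr, hs⟩ := exists_sound_of_computePeSTel G hG P X
  intro v hsub
  simp only [findConf, computeQaSTel, hr] at h hsub
  have hne := QaSTel.minEdges_nonempty (templateOf G (fixPoint G w W μ)) (hG v)
  by_cases hv1 : v ∈ r.W0
  · by_cases hv2 : v ∈ regionOf G (fixPoint G w W μ)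
    · obtain ⟨e, he⟩ := hne
      refine Finset.notMem_empty e (h ▸ Finset.mem_biUnion.mpr
        ⟨v, Finset.mem_inter.mpr ⟨hv1, hv2⟩, ?_⟩)
      rwa [if_pos hsub]
    -- Here `v` belongs to Player 0 and lies outside the quantitative region, so all its edges have
    -- value ∞ and every one of them is minimal.
    · obtain ⟨e, he, hnot⟩ := hs.exists_edge_notMem hG v
      refine hnot (hsub (Finset.mem_filter.mpr ⟨he, fun e' he' => ?_⟩))
      have h0 : v ∈ G.V0 := by
        obtain ⟨f, hf⟩ := hne
        obtain ⟨-, rfl⟩ := GameGraph.mem_out.mp (Finset.mem_filter.mp hf).1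
        rcases Finset.mem_union.mp (hsub hf) with h | h
        · exact (GameGraph.mem_E0.mp ((boundTemplate G r).S_subset h)).2
        · exact (GameGraph.mem_E0.mp ((boundTemplate G r).D_subset h)).2
      rw [act_templateOf (GameGraph.mem_out.mp he').1]
      suffices fixPoint G w W μ e' = ⊤ by rw [this]; exact le_top
      by_contra hfin
      exact hv2 (Finset.mem_filter.mpr ⟨Finset.mem_univ _, Or.inl ⟨h0, e', he', hfin⟩⟩)
  · obtain ⟨e, he⟩ := hne
    refine hs.notMem_bound_of_notMem_W0 ?_ (hsub he)
    rwa [(GameGraph.mem_out.mp (Finset.mem_filter.mp he).1).2]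

theorem findConf_winningEnergyFixed (hG : ∀ v, (G.out v).Nonempty) {c : ℕ}
    (hc : W * Fintype.card V ≤ c) :
    (findConf G w W P X μ).mistel.WinningEnergyFixed w c (parityObj P)
      (findConf G w W P X μ).region := by
  obtain ⟨r, hr, hs⟩ := exists_sound_of_computePeSTel G hG P X
  intro π hπ v hv
  simp only [findConf, computeQaSTel, hr] at hπ hv
  obtain ⟨hv1, hv2⟩ := Finset.mem_inter.mp hv
  refine ⟨fun ρ hρ h0 => ?_, fun ρ hρ h0 => ?_⟩
  · exact energy_of_isPlayOf hG hc (h0 ▸ hv2) (hπ.2 ρ hρ)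
  · exact hs.parity_of_allows hρ.1 (h0 ▸ hv1) (hπ.1 ρ hρ)

/-- Every conflict edge is an edge with a finite activation value. -/
theorem act_ne_top_of_mem_conflicts {e : V × V} (h : e ∈ (findConf G w W P X μ).conflicts) :
    e ∈ G.E ∧ (findConf G w W P X μ).mistel.Q.act e ≠ ⊤ := by
  obtain ⟨v, hv, he⟩ := Finset.mem_biUnion.mp h
  replace hv := (Finset.mem_inter.mp hv).2
  change _ ∧ (templateOf G (fixPoint G w W μ)).act e ≠ ⊤
  change v ∈ regionOf G (fixPoint G w W μ) at hv
  split_ifs at he with hsub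
  · obtain ⟨hout, hmin⟩ := Finset.mem_filter.mp he
    obtain ⟨heE, rfl⟩ := GameGraph.mem_out.mp hout
    refine ⟨heE, fun htop => ?_⟩
    simp only [regionOf, Finset.mem_filter, Finset.mem_univ, true_and] at hv
    rcases hv with ⟨-, e', he', hfin⟩ | ⟨-, hfin⟩
    · have := hmin e' he'
      change (templateOf G (fixPoint G w W μ)).act e ≤ (templateOf G (fixPoint G w W μ)).act e' at this
      rw [htop, act_templateOf (GameGraph.mem_out.mp he').1] at this
      exact hfin (top_le_iff.mp this)
    · exact hfin e hout ((act_templateOf heE).symm.trans htop)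
  · exact absurd he (Finset.notMem_empty _)

theorem le_act_findConf {e : V × V} (he : e ∈ G.E) :
    μ e ≤ (findConf G w W P X μ).mistel.Q.act e := by
  simp only [findConf, computeQaSTel]
  rw [act_templateOf he]
  exact le_fixPoint G w W μ e

/-- `n` bounds the number of edges with finite activation. Every conflict edge is such an edge, and
value iteration keeps the ∞ assigned to it. -/
theorem miSTelLoop_terminates (n : ℕ) (X : Finset V) (r : ConfResult G)
    (hr : ∃ X' μ, r = findConf G w W P X' μ)
    (hn : (G.E.filter fun e => r.mistel.Q.act e ≠ ⊤).card ≤ n) :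
    ∃ R L, MiSTelLoop G w W P X r R L := by
  induction n generalizing X r with
  | zero =>
    obtain ⟨X', μ, rfl⟩ := hr
    refine ⟨_, _, MiSTelLoop.done X _ (Finset.eq_empty_of_forall_notMem fun e he => ?_)⟩
    exact Finset.notMem_empty e (Finset.card_eq_zero.mp (Nat.le_zero.mp hn) ▸
      Finset.mem_filter.mpr (act_ne_top_of_mem_conflicts he))
  | succ n ih =>
    by_cases hC : r.conflicts = ∅
    · exact ⟨_, _, MiSTelLoop.done X r hC⟩
    · obtain ⟨R, L, hL⟩ := ih (X ∩ r.region)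
        (findConf G w W P (X ∩ r.region)
          (fun e => if e ∈ r.conflicts then ⊤ else r.mistel.Q.act e)) ⟨_, _, rfl⟩ (by
          refine Nat.le_of_lt_succ (lt_of_lt_of_le (Finset.card_lt_card ?_) hn)
          obtain ⟨e, he⟩ := Finset.nonempty_iff_ne_empty.mpr hC
          have hle := fun {e} (he : e ∈ G.E) => le_act_findConf (w := w) (W := W) (P := P)
            (X := X ∩ r.region)
            (μ := fun e => if e ∈ r.conflicts then ⊤ else r.mistel.Q.act e) he
          refine (Finset.ssubset_iff_of_subset fun f hf => ?_).mpr ⟨e, ?_, fun hcon => ?_⟩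
          · obtain ⟨hfE, hf⟩ := Finset.mem_filter.mp hf
            refine Finset.mem_filter.mpr ⟨hfE, fun htop => hf (top_le_iff.mp ?_)⟩
            refine le_trans ?_ (hle hfE)
            split_ifs
            · exact le_rfl
            · exact htop.ge
          · obtain ⟨X', μ, rfl⟩ := hr
            exact Finset.mem_filter.mpr (act_ne_top_of_mem_conflicts he)
          · obtain ⟨heE, hcon⟩ := Finset.mem_filter.mp hcon
            refine hcon (top_le_iff.mp (le_trans ?_ (hle heE)))
            rw [if_pos he])
      exact ⟨R, L, MiSTelLoop.step X r R L hC hL⟩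

theorem MiSTelLoop.unique {X : Finset V} {r : ConfResult G} {R R' : Finset V}
    {L L' : MiSTel G} (h : MiSTelLoop G w W P X r R L) (h' : MiSTelLoop G w W P X r R' L') :
    R = R' ∧ L = L' := by
  induction h with
  | done X r h =>
    cases h' with
    | done => exact ⟨rfl, rfl⟩
    | step _ _ _ _ hC => exact absurd h hC
  | step X r R L hC _ ih =>
    cases h' with
    | done _ _ h => exact absurd h hC
    | step _ _ _ _ _ next => exact ih next

theorem MiSTelLoop.exists_findConf {X : Finset V} {r : ConfResult G} {R : Finset V}
    {L : MiSTel G} (h : MiSTelLoop G w W P X r R L) (hr : ∃ X' μ, r = findConf G w W P X' μ) :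
    ∃ X' μ, (findConf G w W P X' μ).conflicts = ∅ ∧ R = (findConf G w W P X' μ).region ∧
      L = (findConf G w W P X' μ).mistel := by
  induction h with
  | done X r h =>
    obtain ⟨X', μ, rfl⟩ := hr
    exact ⟨X', μ, h, rfl, rfl⟩
  | step X r R L hC _ ih => exact ih ⟨_, _, rfl⟩

end MixedGames

theorem mainTheorem7 {V : Type*} [Fintype V] [DecidableEq V] (G : GameGraph V)
    (hG : ∀ v, (G.out v).Nonempty) (w : V × V → ℤ) (W : ℕ) (hW : ∀ e ∈ G.E, |w e| ≤ (W : ℤ))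
    (P : V → ℕ) :
    (∃! r : Finset V × MiSTel G, ComputeMiSTelReturns G w W P r.1 r.2) ∧
    ∀ (R : Finset V) (L : MiSTel G), ComputeMiSTelReturns G w W P R L →
      L.ConflictFree ∧
      L.WinningMeanPayoff w W (parityObj P) R ∧
      L.WinningEnergy w W (parityObj P) R ∧
      ∀ c : ℕ, W * Fintype.card V ≤ c → L.WinningEnergyFixed w c (parityObj P) R := by
  refine ⟨?_, fun R L h => ?_⟩
  · obtain ⟨R, L, h⟩ := miSTelLoop_terminates _ Finset.univ
      (findConf G w W P Finset.univ (fun _ => 0)) ⟨_, _, rfl⟩ le_rfl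
    refine ⟨(R, L), h, fun r hr => ?_⟩
    obtain ⟨h1, h2⟩ := MiSTelLoop.unique hr h
    exact Prod.ext h1 h2
  · obtain ⟨X, μ, hC, rfl, rfl⟩ := MiSTelLoop.exists_findConf h ⟨_, _, rfl⟩
    refine ⟨findConf_conflictFree hG hC, ?_, ?_, fun c hc => findConf_winningEnergyFixed hG hc⟩
    · rintro π ⟨c, hc, hπ⟩ v hv
      have hwin := findConf_winningEnergyFixed hG hc π hπ v hv
      exact ⟨fun ρ hρ h0 => energyObj_subset_meanPayoffObj hW hρ.1 (hwin.1 ρ hρ h0), hwin.2⟩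
    · rintro π ⟨c, hc, hπ⟩ v hv
      have hwin := findConf_winningEnergyFixed hG hc π hπ v hv
      exact ⟨⟨c, hwin.1⟩, hwin.2⟩
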